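/- Let $q$ be a prime power, $m\ge 2$, $k,t$ non-negative integers, $V=\mathbb F_{q^m}^k$, and let $\mathrm U=(U_1,\dots,U_t)$ be an ordered tuple of $\mathbb F_q$-subspaces of $V$. Definitions. $\mathrm U$ is an $(s,A)_q$-subspace design in $V$ if $\dim_{\mathbb F_{q^m}}\langle U_1,\dots,U_t\rangle_{\mathbb F_{q^m}}\ge s$ and $\sum_{i=1}^t\dim_{\mathbb F_q}(U_i\cap W)\le A$ for every $\mathbb F_{q^m}$-subspace $W\subseteq V$ of dimension $s$. It is a maximum $1$-design if it is a $(1,1)_q$-subspace design, $m\ge 2$ and $\sum_{i=1}^t\dim_{\mathbb F_q}U_i=t\,\frac{mk}{2}$. For $\mathbf n=(n_1,\dots,n_t)$ with $n_1\ge\dots\ge n_t$, the sum-rank weight of $x=(x_1,\dots,x_t)\in\mathbb F_{q^m}^{\mathbf n}=\bigoplus_i\mathbb F_{q^m}^{n_i}$ is $\mathrm w(x)=\sum_i \mathrm{rk}_q(x_i)$, where $\mathrm{rk}_q(x_i)$ is the dimension of the $\mathbb F_q$-span of the entries of $x_i$. An $[\mathbf n,k,d]_{q^m/q}$ code is a $k$-dimensional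 $\mathbb F_{q^m}$-subspace $\mathrm C$ of $\mathbb F_{q^m}^{\mathbf n}$ with minimum distance $d=\min\{\mathrm w(x-y):x,y\in\mathrm C,\ x\ne y\}$. It is MSRD if it attains the Singleton bound, that is, $|\mathrm C|=q^{\,m\sum_{i=j}^t n_i-\max\{m,n_j\}\delta}$, where $j,\delta$ are the unique integers with $d-1=\sum_{i=1}^{j-1}\min\{m,n_i\}+\delta$ and $0\le\delta\le\min\{m,n_j\}-1$. If $\dim_{\mathbb F_q}U_i=n_i$ for all $i$, then $\Phi([\mathrm U])$ denotes the set of all codes in $\mathbb F_{q^m}^{\mathbf n}$ that are the image, under an $\mathbb F_{q^m}$-linear sum-rank isometry of $\mathbb F_{q^m}^{\mathbf n}$, of a code generated by the rows of a matrix $(G_1\mid\dots\mid G_t)$ for which the columns of $G_i$ form an $\mathbb F_q$-basis of $U_i$ for each $i$. Then: (a) If $\mathrm U$ is a maximum $1$-design in $V$ and $\sigma:V\times V\to\mathbb F_{q^m}$ is a non-degenerate reflexive sesquilinear form (linear in the first argument), then $(U_1^{\tau'},\dots,U_t^{\tau'})$ is a maximum $1$-design in $V$, where $U_i^{\tau'}=\{v\in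 V:\mathrm{Tr}_{q^m/q}(\sigma(v,u))=0\text{ for all }u\in U_i\}$. (b) Let $k\ge 2$, let $mk$ be even and let $\dim_{\mathbb F_q}U_i=\frac{mk}{2}$ for all $i$. Then $\mathrm U$ is a maximum $1$-design in $V$ if and only if it is a $\left(k-1,\frac{tm(k-2)}{2}+1\right)_q$-subspace design in $V$. (c) Let $k\ge 2$, let $mk$ be even, let $\dim_{\mathbb F_q}U_i=\frac{mk}{2}$ for all $i$, and let $\langle U_1,\dots,U_t\rangle_{\mathbb F_{q^m}}=V$. Then every code in $\Phi([\mathrm U])$ is an $[\mathbf n,k,d]_{q^m/q}$ MSRD code with $\mathbf n=\left(\frac{mk}{2},\dots,\frac{mk}{2}\right)$ and $d=mt-1$ if and only if $\mathrm U$ is a maximum $1$-design in $V$. -/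

import Mathlib

namespace SubspaceDesign

open Module

section Designs

variable (F L : Type*) [Field F] [Field L] [Algebra F L]
variable {V : Type*} [AddCommGroup V] [Module F V] [Module L V]

/-- The `L`-subspace `⟨U_1, …, U_t⟩_L` of `V` spanned by a tuple of `F`-subspaces. -/
def spanOver {t : ℕ} (U : Fin t → Submodule F V) : Submodule L V :=
  Submodule.span L (⋃ i, (U i : Set V))

variable [IsScalarTower F L V]

/-- `(U_1, …, U_t)` is an `(s, A)_q`-subspace design in `V`, where `q = |F|`. -/
def IsSubspaceDesign {t : ℕ} (s A : ℕ) (U : Fin t → Submodule F V) : Prop :=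
  s ≤ finrank L (spanOver F L U) ∧
    ∀ W : Submodule L V, finrank L W = s →
      ∑ i, finrank F (U i ⊓ W.restrictScalars F : Submodule F V) ≤ A

/-- An `s`-design is an `(s, s)_q`-subspace design. -/
def IsDesign {t : ℕ} (s : ℕ) (U : Fin t → Submodule F V) : Prop :=
  IsSubspaceDesign F L s s U

/-- A maximum `s`-design: with `m = [L : F]` and `k = dim_L V`, an `s`-design such that
`m ≥ s + 1` and `dim_F U_1 + ⋯ + dim_F U_t = t * (m * k) / (s + 1)`. -/
def IsMaximumDesign {t : ℕ} (s : ℕ) (U : Fin t → Submodule F V) : Prop :=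
  IsDesign F L s U ∧ s + 1 ≤ finrank F L ∧
    ((∑ i, finrank F (U i) : ℕ) : ℚ) =
      t * ((finrank F L : ℚ) * (finrank L V : ℚ) / ((s : ℚ) + 1))

variable {F L}

/-- The dual of the `F`-subspace `U` of `V` with respect to `(u, v) ↦ Tr_{L/F} (σ (u, v))`,
where `σ` is a sesquilinear form on the `L`-space `V`. -/
def traceDual {θ : L →+* L} (σ : V →ₗ[L] V →ₛₗ[θ] L) (U : Submodule F V) : Submodule F V where
  carrier := {v | ∀ u ∈ U, Algebra.trace F L (σ v u) = 0}
  zero_mem' := by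
    intro u _
    simp
  add_mem' := by
    intro a b ha hb u hu
    simp [ha u hu, hb u hu]
  smul_mem' := by
    intro c a ha u hu
    have h : σ (c • a) u = c • σ a u := by
      rw [← algebraMap_smul L c a, map_smul, LinearMap.smul_apply, algebraMap_smul]
    rw [h, map_smul, ha u hu, smul_zero]

end Designs

section Codes

variable (F : Type*) {L : Type*} [Field F] [Field L] [Algebra F L]
variable {t : ℕ} {n : Fin t → ℕ}

/-- The rank of a vector over `L`: the dimension of the `F`-span of its entries. -/
noncomputable def rankWeight {N : ℕ} (v : Fin N → L) : ℕ :=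
  finrank F (Submodule.span F (Set.range v))

/-- The sum-rank weight of `x = (x_1, …, x_t) ∈ L^{n_1} ⊕ ⋯ ⊕ L^{n_t}`. -/
noncomputable def sumRankWeight (x : ∀ i, Fin (n i) → L) : ℕ :=
  ∑ i, rankWeight F (x i)

/-- The sum-rank distance. -/
noncomputable def sumRankDist (x y : ∀ i, Fin (n i) → L) : ℕ :=
  sumRankWeight F (x - y)

/-- `d` is the minimum sum-rank distance of the linear code `C`. -/
def IsMinDist (C : Submodule L (∀ i, Fin (n i) → L)) (d : ℕ) : Prop :=
  IsLeast {e | ∃ x ∈ C, ∃ y ∈ C, x ≠ y ∧ sumRankDist F x y = e} d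

/-- `C` is an `[(n_1, …, n_t), k, d]_{q^m/q}` code. -/
def IsCode (C : Submodule L (∀ i, Fin (n i) → L)) (k d : ℕ) : Prop :=
  finrank L C = k ∧ IsMinDist F C d

/-- `C` is a maximum sum-rank distance code: its block lengths are non-increasing and its size
attains the Singleton bound. If `d` is the minimum distance, `m = [L : F]`, `q = |F|`, and
`d - 1 = ∑_{i < j} min (m, n_i) + δ` with `0 ≤ δ ≤ min (m, n_j) - 1`, this bound is
`|C| ≤ q ^ (m * ∑_{i ≥ j} n_i - max (m, n_j) * δ)`. The subtraction in the exponent is a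
genuine one, because `max (m, n_j) * δ ≤ max (m, n_j) * min (m, n_j) = m * n_j`. -/
def IsMSRD (C : Submodule L (∀ i, Fin (n i) → L)) : Prop :=
  Antitone n ∧ ∃ (d : ℕ) (j : Fin t) (δ : ℕ), IsMinDist F C d ∧
    d = ∑ i ∈ Finset.Iio j, min (finrank F L) (n i) + δ + 1 ∧
    δ < min (finrank F L) (n j) ∧
    Nat.card C = Nat.card F ^
      (finrank F L * ∑ i ∈ Finset.Ici j, n i - max (finrank F L) (n j) * δ)

/-- Equivalence of codes: some `L`-linear isometry of the ambient space for the sum-rank metric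
maps one onto the other. -/
def CodeEquiv (C D : Submodule L (∀ i, Fin (n i) → L)) : Prop :=
  ∃ φ : (∀ i, Fin (n i) → L) ≃ₗ[L] (∀ i, Fin (n i) → L),
    (∀ x, sumRankWeight F (φ x) = sumRankWeight F x) ∧ C.map φ.toLinearMap = D

/-- The code generated by the rows of the block matrix `G = (G_1 | ⋯ | G_t)`. -/
def codeOfMatrix {k : ℕ} (G : ∀ i, Matrix (Fin k) (Fin (n i)) L) :
    Submodule L (∀ i, Fin (n i) → L) :=
  Submodule.span L (Set.range fun (r : Fin k) (i : Fin t) (c : Fin (n i)) => G i r c)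

variable (n) in
/-- The class of codes with block lengths `n` associated with `(U_1, …, U_t)`: all codes
equivalent to one generated by a matrix `(G_1 | ⋯ | G_t)` such that the columns of `G_i` form
an `F`-basis of `U_i` for every `i`. -/
def associatedCodes {k : ℕ} (U : Fin t → Submodule F (Fin k → L)) :
    Set (Submodule L (∀ i, Fin (n i) → L)) :=
  {C | ∃ G : ∀ i, Matrix (Fin k) (Fin (n i)) L,
    (∀ i, LinearIndependent F (fun c r => G i r c) ∧
      Submodule.span F (Set.range fun c r => G i r c) = U i) ∧
    CodeEquiv F (codeOfMatrix G) C}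

end Codes

end SubspaceDesign

set_option linter.unusedSectionVars false

/-! All three parts reduce to one condition on hyperplanes. For a functional `f` on `V`, the defect
of `U i` is `m - dim f(U i)`; the condition is that the defects sum to at most 1 for every `f ≠ 0`.

A maximum 1-design satisfies it by a second-moment argument. Put `Q = q ^ m`. The number of zeros of
`f` on `U i` is `|U i| / Q * q ^ defect`, and its moments over all `f` depend only on how many pairs
of nonzero vectors are `L`-dependent, which the 1-design property determines. Over `f ≠ 0`, the
product of the deviations from the values for defects 0 and 1 sums to a positive multiple of `Q ^ k
- |U i| ^ 2` (`IsScatteredTuple.sum_self`). No power of `q` lies strictly between `1` and `q`, so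
every term is nonnegative; hence `dim U i ≤ mk / 2`, and equality forces defects 0 or 1. The mixed
sum for `i ≠ j` (`IsScatteredTuple.sum_cross`) then vanishes too, so two members never both have
positive defect.

For (a), the trace dual of `U` meets the line of `v` in dimension equal to a defect of `U`
(`finrank_traceDual_inf_span`), so the hyperplane condition says exactly that the dual tuple is
scattered. Dualizing twice with the dot product gives the converse implication. For (b), `dim (U i ∩
ker f) = dim U i - m + defect`. For (c), a codeword has weight `mt` minus the sum of defects. -/

namespace SubspaceDesign

open Module

/-! ### Zeros of a functional on an `F`-subspace. -/

section Kernel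
variable {F L V : Type*} [Field F] [Field L] [Algebra F L]
  [AddCommGroup V] [Module F V] [Module L V] [IsScalarTower F L V]

/-- The image of an `F`-subspace under an `L`-linear functional. -/
def evalImage (f : Dual L V) (U : Submodule F V) : Submodule F L :=
  U.map (f.restrictScalars F)

/-- The codimension in `L` of the image of an `F`-subspace under an `L`-linear functional. -/
noncomputable def defect (f : Dual L V) (U : Submodule F V) : ℕ :=
  finrank F L - finrank F (evalImage f U)

/-- The number of vectors of `U` annihilated by `f`. -/
noncomputable def kerCard (f : Dual L V) (U : Submodule F V) : ℚ :=
  Nat.card {u : U // f u = 0}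

theorem finrank_evalImage_add_defect [FiniteDimensional F L] (f : Dual L V) (U : Submodule F V) :
    finrank F (evalImage f U) + defect f U = finrank F L := by
  have := Submodule.finrank_le (evalImage f U)
  unfold defect
  omega

theorem finite_scalars (F L : Type*) [Field F] [Field L] [Algebra F L] [Finite F]
    [FiniteDimensional F L] : Finite L := Module.finite_of_finite F

theorem finite_space (F L V : Type*) [Field F] [Field L] [Algebra F L] [Finite F]
    [FiniteDimensional F L] [AddCommGroup V] [Module L V] [FiniteDimensional L V] : Finite V :=
  have := finite_scalars F L
  Module.finite_of_finite L

/-- Rank-nullity for `f` restricted to `U`, multiplied out so that no exponent is a difference. -/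
theorem kerCard_mul_pow [Finite F] [FiniteDimensional F L] [FiniteDimensional L V] (f : Dual L V) (U : Submodule F V) :
    kerCard f U * (Nat.card F : ℚ) ^ finrank F L =
      (Nat.card F : ℚ) ^ finrank F U * (Nat.card F : ℚ) ^ defect f U := by
  have : FiniteDimensional F V := Module.Finite.trans L V
  let g : U →ₗ[F] L := (f.restrictScalars F).domRestrict U
  have h1 : kerCard f U = (Nat.card F : ℚ) ^ finrank F (LinearMap.ker g) := by
    unfold kerCard
    rw [← Nat.cast_pow, ← Module.natCard_eq_pow_finrank (K := F)]
    rfl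
  have h2 : LinearMap.range g = evalImage f U := by
    simp [g, evalImage, LinearMap.range_domRestrict]
  have h3 := g.finrank_range_add_finrank_ker
  have h4 := finrank_evalImage_add_defect f U
  rw [h2] at h3
  rw [h1, ← pow_add, ← pow_add]
  congr 1
  omega

end Kernel

/-! ### Functionals vanishing at two given vectors. -/

section Count
variable {L V : Type*} [Field L] [AddCommGroup V] [Module L V] [FiniteDimensional L V]

theorem card_dual_vanishing (S : Submodule L V) :
    (Nat.card {f : Dual L V // ∀ x ∈ S, f x = 0} : ℚ) * (Nat.card L : ℚ) ^ finrank L S =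
      (Nat.card L : ℚ) ^ finrank L V := by
  have h1 : Nat.card {f : Dual L V // ∀ x ∈ S, f x = 0} =
      Nat.card L ^ finrank L S.dualAnnihilator := by
    rw [← Module.natCard_eq_pow_finrank (K := L) (V := S.dualAnnihilator)]
    exact Nat.card_congr (Equiv.subtypeEquivRight fun f => by
      rw [Submodule.mem_dualAnnihilator])
  have h2 := Subspace.finrank_add_finrank_dualAnnihilator_eq S
  rw [h1, Nat.cast_pow, ← pow_add, add_comm, h2]

theorem card_dual_vanishing_pair (x y : V) :
    (Nat.card {f : Dual L V // f x = 0 ∧ f y = 0} : ℚ) *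
      (Nat.card L : ℚ) ^ finrank L (Submodule.span L {x, y}) = (Nat.card L : ℚ) ^ finrank L V := by
  rw [← card_dual_vanishing (Submodule.span L {x, y})]
  congr 2
  refine Nat.card_congr (Equiv.subtypeEquivRight fun f => ?_)
  have : (∀ z ∈ Submodule.span L {x, y}, f z = 0) ↔ Submodule.span L {x, y} ≤ LinearMap.ker f :=
    Iff.rfl
  rw [this, Submodule.span_le]
  simp [Set.insert_subset_iff]

-- The first summand is the value for independent events and factors over `x` and `y`; the second
-- corrects for dependent nonzero pairs. This form lets the double sum over `U × U'` split.
open Classical in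
theorem card_dual_vanishing_pair_eq [Finite L] (x y : V) :
    (Nat.card {f : Dual L V // f x = 0 ∧ f y = 0} : ℚ) =
      (Nat.card L : ℚ) ^ finrank L V *
        ((if x = 0 then 1 else (Nat.card L : ℚ)⁻¹) * (if y = 0 then 1 else (Nat.card L : ℚ)⁻¹) +
          if x ≠ 0 ∧ y ≠ 0 ∧ y ∈ Submodule.span L {x} then
            (Nat.card L : ℚ)⁻¹ - ((Nat.card L : ℚ)⁻¹) ^ 2 else 0) := by
  have hQ : (Nat.card L : ℚ) ≠ 0 := by exact_mod_cast Nat.card_pos.ne'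
  have h := card_dual_vanishing_pair (L := L) x y
  by_cases hx : x = 0
  · by_cases hy : y = 0
    · subst hx hy
      have : Submodule.span L {(0 : V), 0} = ⊥ := by simp
      rw [this, finrank_bot] at h
      simpa using h
    · have : finrank L (Submodule.span L {x, y}) = 1 := by
        subst hx
        rw [Submodule.span_insert_zero, finrank_span_singleton hy]
      rw [this] at h
      simp only [hx, hy, ← h] at *
      simp
      field_simp
  · by_cases hy : y ∈ Submodule.span L {x}
    · have : finrank L (Submodule.span L {x, y}) = 1 := by
        rw [Set.pair_comm, Submodule.span_insert_eq_span hy, finrank_span_singleton hx]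
      rw [this] at h
      by_cases hy0 : y = 0
      · simp only [hx, hy0, ← h]
        simp
        field_simp
      · rw [if_neg hx, if_neg hy0, if_pos ⟨hx, hy0, hy⟩, ← h]
        field_simp
        ring
    · have hli : LinearIndependent L ![x, y] := by
        rw [LinearIndependent.pair_iff' hx]
        intro a ha
        exact hy (ha ▸ Submodule.smul_mem _ _ (Submodule.mem_span_singleton_self x))
      have : finrank L (Submodule.span L {x, y}) = 2 := by
        have := finrank_span_eq_card hli
        rwa [Matrix.range_cons_cons_empty, Fintype.card_fin] at this
      rw [this] at h
      have hy0 : y ≠ 0 := by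
        rintro rfl
        exact hy (zero_mem _)
      simp only [hx, hy0, hy, ← h]
      simp
      field_simp

end Count

/-! ### First and second moments of the number of zeros. -/

section Moments
variable {F L V : Type*} [Field F] [Field L] [AddCommGroup V] [Module F V] [Module L V]

theorem kerCard_zero (U : Submodule F V) : kerCard (0 : Dual L V) U = Nat.card U := by
  unfold kerCard
  norm_cast
  exact Nat.card_congr (Equiv.subtypeUnivEquiv fun u => by simp)

theorem kerCard_bot (f : Dual L V) : kerCard f (⊥ : Submodule F V) = 1 := by
  unfold kerCard
  have : Unique {u : (⊥ : Submodule F V) // f u = 0} :=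
    { default := ⟨0, by simp⟩, uniq := fun a => Subtype.ext (Subsingleton.elim _ _) }
  simp

open Classical in
theorem natCast_card_subtype_eq_sum {α : Type*} [Fintype α] (p : α → Prop) :
    (Nat.card {a // p a} : ℚ) = ∑ a, if p a then 1 else 0 := by
  rw [Nat.card_eq_fintype_card, Fintype.card_subtype, Finset.sum_boole]

open Classical in
/-- The number of linearly dependent pairs of nonzero vectors in `U × U'`. -/
noncomputable def dependentPairs (L : Type*) [Field L] [Module L V] (U U' : Submodule F V)
    [Fintype U] [Fintype U'] : ℚ :=
  ∑ u : U, ∑ u' : U',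
    if (u : V) ≠ 0 ∧ (u' : V) ≠ 0 ∧ (u' : V) ∈ Submodule.span L {(u : V)} then 1 else 0

/-- Double counting of triples `(f, u, u')` with `f u = f u' = 0`. -/
theorem sum_kerCard_mul_kerCard [Fintype (Dual L V)] (U U' : Submodule F V)
    [Fintype U] [Fintype U'] :
    ∑ f : Dual L V, kerCard f U * kerCard f U' =
      ∑ u : U, ∑ u' : U', (Nat.card {f : Dual L V // f u = 0 ∧ f u' = 0} : ℚ) := by
  classical
  simp only [kerCard, natCast_card_subtype_eq_sum, Finset.sum_mul_sum]
  rw [Finset.sum_comm]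
  refine Finset.sum_congr rfl fun u _ => ?_
  rw [Finset.sum_comm]
  refine Finset.sum_congr rfl fun u' _ => Finset.sum_congr rfl fun f _ => ?_
  by_cases h : f u = 0 <;> simp [h]

open Classical in
theorem sum_ite_eq_zero (U : Submodule F V) [Fintype U] (c : ℚ) :
    ∑ u : U, (if (u : V) = 0 then 1 else c) = 1 - c + Nat.card U * c := by
  have h : ∀ u : U, (if (u : V) = 0 then 1 else c) = (if u = 0 then 1 - c else 0) + c := by
    intro u
    by_cases hu : u = 0 <;> simp [hu]
  simp only [h, Finset.sum_add_distrib, Finset.sum_ite_eq', Finset.mem_univ, if_true,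
    Finset.sum_const, nsmul_eq_mul, Finset.card_univ, Nat.card_eq_fintype_card]

theorem sum_kerCard_mul_kerCard_eq [Finite L] [FiniteDimensional L V] [Fintype (Dual L V)]
    (U U' : Submodule F V) [Fintype U] [Fintype U'] {c : ℚ} (hc : c = (Nat.card L : ℚ)⁻¹) :
    ∑ f : Dual L V, kerCard f U * kerCard f U' =
      (Nat.card L : ℚ) ^ finrank L V * ((1 - c + Nat.card U * c) * (1 - c + Nat.card U' * c) +
        dependentPairs L U U' * (c - c ^ 2)) := by
  classical
  subst hc
  rw [sum_kerCard_mul_kerCard]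
  simp only [card_dual_vanishing_pair_eq, ← Finset.mul_sum, Finset.sum_add_distrib,
    sum_ite_eq_zero, ← Finset.sum_mul, dependentPairs]
  congr 2
  rw [Finset.sum_mul]
  refine Finset.sum_congr rfl fun u _ => ?_
  rw [Finset.sum_mul]
  exact Finset.sum_congr rfl fun u' _ => by simp only [ite_mul, one_mul, zero_mul]

theorem dependentPairs_bot (U : Submodule F V) [Fintype U] [Fintype (⊥ : Submodule F V)] :
    dependentPairs L U ⊥ = 0 := by
  unfold dependentPairs
  refine Finset.sum_eq_zero fun u _ => Finset.sum_eq_zero fun u' _ => if_neg fun h => h.2.1 ?_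
  exact (Submodule.mem_bot F).1 u'.2

theorem sum_kerCard [Finite L] [FiniteDimensional L V] [Fintype (Dual L V)]
    (U : Submodule F V) [Fintype U] {c : ℚ} (hc : c = (Nat.card L : ℚ)⁻¹) :
    ∑ f : Dual L V, kerCard f U =
      (Nat.card L : ℚ) ^ finrank L V * (1 - c + Nat.card U * c) := by
  have : Fintype (⊥ : Submodule F V) := Fintype.ofFinite _
  -- The first moment is the mixed moment with `⊥`, on which every functional has exactly one zero.
  have h := sum_kerCard_mul_kerCard_eq (L := L) U ⊥ hc
  simpa [kerCard_bot, dependentPairs_bot] using h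

-- The zero functional is removed because it vanishes on all of `U` and `U'`, and the defect bounds
-- concern nonzero functionals only.
open Classical in
theorem sum_kerCard_sub_mul_kerCard_sub [Finite L] [FiniteDimensional L V] [Fintype (Dual L V)]
    (U U' : Submodule F V) [Fintype U] [Fintype U'] {c : ℚ} (hc : c = (Nat.card L : ℚ)⁻¹)
    (a b : ℚ) :
    ∑ f ∈ Finset.univ.erase (0 : Dual L V), (kerCard f U - a) * (kerCard f U' - b) =
      (Nat.card L : ℚ) ^ finrank L V *
        ((1 - c + Nat.card U * c - a) * (1 - c + Nat.card U' * c - b) +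
          dependentPairs L U U' * (c - c ^ 2)) - (Nat.card U - a) * (Nat.card U' - b) := by
  rw [Finset.sum_erase_eq_sub (Finset.mem_univ _), kerCard_zero, kerCard_zero]
  congr 1
  have h : ∀ f : Dual L V, (kerCard f U - a) * (kerCard f U' - b) =
      kerCard f U * kerCard f U' - kerCard f U * b - a * kerCard f U' + a * b := fun f => by ring
  simp only [h, Finset.sum_add_distrib, Finset.sum_sub_distrib, ← Finset.sum_mul,
    ← Finset.mul_sum, sum_kerCard_mul_kerCard_eq U U' hc, sum_kerCard U hc, sum_kerCard U' hc]
  have hd : (∑ _f : Dual L V, a * b) = (Nat.card L : ℚ) ^ finrank L V * (a * b) := by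
    rw [Finset.sum_const, nsmul_eq_mul, Finset.card_univ, ← Nat.card_eq_fintype_card,
      Module.natCard_eq_pow_finrank (K := L), Subspace.dual_finrank_eq, Nat.cast_pow]
  rw [← Finset.sum_mul] at hd
  rw [hd]
  ring

end Moments

/-! ### Scattered tuples: the dimension bound and the case of equality. -/

section Scattered
variable {F L V : Type*} [Field F] [Field L] [Algebra F L]
  [AddCommGroup V] [Module F V] [Module L V] [IsScalarTower F L V]

variable (L) in
/-- Every one-dimensional `L`-subspace meets the members of the tuple in total dimension
at most one. -/
def IsScatteredTuple {t : ℕ} (U : Fin t → Submodule F V) : Prop :=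
  ∀ W : Submodule L V, finrank L W = 1 →
    ∑ i, finrank F (U i ⊓ W.restrictScalars F : Submodule F V) ≤ 1

/-- The number of dependent pairs in `U × U'` is the sum over the nonzero `u ∈ U` of the number
of nonzero vectors in `U' ∩ ⟨u⟩`. -/
theorem dependentPairs_eq_sum (U U' : Submodule F V) [Fintype U] [Fintype U'] (n : ℕ)
    (h : ∀ u ∈ U, u ≠ 0 →
      Nat.card (U' ⊓ (Submodule.span L {u}).restrictScalars F : Submodule F V) = n) :
    dependentPairs L U U' = (Nat.card U - 1) * (n - 1) := by
  classical
  have key : ∀ u : U, (∑ u' : U',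
      if (u : V) ≠ 0 ∧ (u' : V) ≠ 0 ∧ (u' : V) ∈ Submodule.span L {(u : V)} then (1 : ℚ) else 0) =
      (n - 1) - if u = 0 then ((n : ℚ) - 1) else 0 := by
    intro u
    by_cases hu : u = 0
    · simp [hu]
    · have hu' : (u : V) ≠ 0 := by simpa using hu
      have h1 : ∀ u' : U',
          (if (u : V) ≠ 0 ∧ (u' : V) ≠ 0 ∧ (u' : V) ∈ Submodule.span L {(u : V)}
            then (1 : ℚ) else 0) =
          (if (u' : V) ∈ Submodule.span L {(u : V)} then 1 else 0) - if u' = 0 then 1 else 0 := by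
        intro u'
        by_cases h0 : u' = 0
        · simp [h0]
        · have : (u' : V) ≠ 0 := by simpa using h0
          simp [h0, hu']
      simp only [h1, Finset.sum_sub_distrib, Finset.sum_ite_eq', Finset.mem_univ, if_true,
        if_neg hu, sub_zero]
      rw [← natCast_card_subtype_eq_sum, ← h u u.2 hu']
      congr 2
      refine Nat.card_congr ?_
      exact (Equiv.subtypeSubtypeEquivSubtypeInter (fun x => x ∈ U')
        (fun x => x ∈ Submodule.span L {(u : V)}))
  unfold dependentPairs
  simp only [key, Finset.sum_sub_distrib, Finset.sum_const, nsmul_eq_mul, Finset.sum_ite_eq',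
    Finset.mem_univ, if_true, Finset.card_univ, Nat.card_eq_fintype_card]
  ring

variable [FiniteDimensional F L] [FiniteDimensional L V]

theorem one_le_finrank_inf_span {U : Submodule F V} {u : V} (hu : u ∈ U) (h0 : u ≠ 0) :
    1 ≤ finrank F (U ⊓ (Submodule.span L {u}).restrictScalars F : Submodule F V) := by
  have : FiniteDimensional F V := Module.Finite.trans L V
  rw [Submodule.one_le_finrank_iff]
  exact (Submodule.ne_bot_iff _).2 ⟨u, ⟨hu, Submodule.mem_span_singleton_self u⟩, h0⟩

variable [Finite F]

theorem IsScatteredTuple.finrank_self {t : ℕ} {U : Fin t → Submodule F V}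
    (h : IsScatteredTuple L U) {i : Fin t} {u : V} (hu : u ∈ U i) (h0 : u ≠ 0) :
    finrank F (U i ⊓ (Submodule.span L {u}).restrictScalars F : Submodule F V) = 1 := by
  refine le_antisymm ?_ (one_le_finrank_inf_span hu h0)
  exact (Finset.single_le_sum (f := fun i => finrank F
    (U i ⊓ (Submodule.span L {u}).restrictScalars F : Submodule F V)) (fun _ _ => Nat.zero_le _)
    (Finset.mem_univ i)).trans (h _ (finrank_span_singleton h0))

theorem IsScatteredTuple.finrank_of_ne {t : ℕ} {U : Fin t → Submodule F V}
    (h : IsScatteredTuple L U) {i j : Fin t} (hij : i ≠ j) {u : V} (hu : u ∈ U i) (h0 : u ≠ 0) :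
    finrank F (U j ⊓ (Submodule.span L {u}).restrictScalars F : Submodule F V) = 0 := by
  have h1 := (Finset.add_le_sum (f := fun i => finrank F
    (U i ⊓ (Submodule.span L {u}).restrictScalars F : Submodule F V)) (s := Finset.univ)
    (fun _ _ => Nat.zero_le _)
    (Finset.mem_univ i) (Finset.mem_univ j) hij).trans (h _ (finrank_span_singleton h0))
  have h2 := h.finrank_self hu h0
  simp only [h2] at h1
  omega

theorem kerCard_eq (f : Dual L V) (U : Submodule F V) :
    kerCard f U = Nat.card U * (Nat.card L : ℚ)⁻¹ * (Nat.card F : ℚ) ^ defect f U := by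
  have := finite_scalars F L
  have : FiniteDimensional F V := Module.Finite.trans L V
  have hQ : (Nat.card L : ℚ) ≠ 0 := by exact_mod_cast Nat.card_pos.ne'
  have h := kerCard_mul_pow f U
  have h1 : (Nat.card L : ℚ) = (Nat.card F : ℚ) ^ finrank F L := by
    rw [Module.natCard_eq_pow_finrank (K := F) (V := L), Nat.cast_pow]
  have h2 : (Nat.card U : ℚ) = (Nat.card F : ℚ) ^ finrank F U := by
    rw [Module.natCard_eq_pow_finrank (K := F) (V := U), Nat.cast_pow]
  rw [← h1, ← h2] at h
  field_simp
  linarith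

-- A line through a nonzero vector of `U i` misses `U j`, so there are no dependent pairs. The shift
-- `|U| * c` is the number of zeros of a functional of defect 0.
open Classical in
theorem IsScatteredTuple.sum_cross [Fintype (Dual L V)] {t : ℕ} {U : Fin t → Submodule F V}
    (h : IsScatteredTuple L U) {i j : Fin t} (hij : i ≠ j) {c : ℚ}
    (hc : c = (Nat.card L : ℚ)⁻¹) :
    ∑ f ∈ Finset.univ.erase (0 : Dual L V),
      (kerCard f (U i) - Nat.card (U i) * c) * (kerCard f (U j) - Nat.card (U j) * c) =
      (1 - c) ^ 2 * ((Nat.card L : ℚ) ^ finrank L V - Nat.card (U i) * Nat.card (U j)) := by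
  have := finite_space F L V
  have := finite_scalars F L
  have : Fintype (U i) := Fintype.ofFinite _
  have : Fintype (U j) := Fintype.ofFinite _
  have hd : dependentPairs L (U i) (U j) = 0 := by
    rw [dependentPairs_eq_sum (U i) (U j) 1]
    · simp
    · intro u hu h0
      rw [Module.natCard_eq_pow_finrank (K := F), h.finrank_of_ne hij hu h0, pow_zero]
  rw [sum_kerCard_sub_mul_kerCard_sub _ _ hc, hd]
  ring

-- The two shifts are the numbers of zeros for defects 0 and 1. Each nonzero `u` has `q - 1`
-- dependent partners, and with these shifts the terms of the moment linear in `|U i|` cancel.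
open Classical in
theorem IsScatteredTuple.sum_self [Fintype (Dual L V)] {t : ℕ} {U : Fin t → Submodule F V}
    (h : IsScatteredTuple L U) (i : Fin t) {c : ℚ} (hc : c = (Nat.card L : ℚ)⁻¹) :
    ∑ f ∈ Finset.univ.erase (0 : Dual L V), (kerCard f (U i) - Nat.card (U i) * c) *
      (kerCard f (U i) - Nat.card F * (Nat.card (U i) * c)) =
      (1 - c) * (1 - Nat.card F * c) *
        ((Nat.card L : ℚ) ^ finrank L V - (Nat.card (U i)) ^ 2) := by
  have := finite_space F L V
  have := finite_scalars F L
  have : Fintype (U i) := Fintype.ofFinite _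
  have hd : dependentPairs L (U i) (U i) = (Nat.card (U i) - 1) * (Nat.card F - 1) := by
    refine dependentPairs_eq_sum (U i) (U i) _ fun u hu h0 => ?_
    rw [Module.natCard_eq_pow_finrank (K := F), h.finrank_self hu h0, pow_one]
  rw [sum_kerCard_sub_mul_kerCard_sub _ _ hc, hd]
  ring

theorem one_lt_natCard_cast (F : Type*) [Field F] [Finite F] : (1 : ℚ) < Nat.card F := by
  exact_mod_cast Finite.one_lt_card

theorem natCard_mul_inv_lt_one (hm : 2 ≤ finrank F L) :
    (Nat.card F : ℚ) * (Nat.card L : ℚ)⁻¹ < 1 := by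
  have := finite_scalars F L
  have hq := one_lt_natCard_cast F
  have h1 : (Nat.card L : ℚ) = (Nat.card F : ℚ) ^ finrank F L := by
    rw [Module.natCard_eq_pow_finrank (K := F) (V := L), Nat.cast_pow]
  have hlt : (Nat.card F : ℚ) < Nat.card L := by
    rw [h1]
    calc (Nat.card F : ℚ) = (Nat.card F : ℚ) ^ 1 := (pow_one _).symm
      _ < _ := pow_lt_pow_right₀ hq (by omega)
  rw [← div_eq_mul_inv, div_lt_one (by linarith)]
  exact hlt

/-- Integrality of `d` matters: the product is negative for `0 < d < 1`. -/
theorem pow_sub_one_mul_pow_sub_nonneg {q : ℚ} (hq : 1 < q) (d : ℕ) :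
    0 ≤ (q ^ d - 1) * (q ^ d - q) := by
  rcases Nat.eq_zero_or_pos d with rfl | hd
  · simp
  · refine mul_nonneg (sub_nonneg.2 (one_le_pow₀ hq.le)) (sub_nonneg.2 ?_)
    exact le_self_pow₀ hq.le hd.ne'

theorem self_term_eq (f : Dual L V) (U : Submodule F V) {c : ℚ} (hc : c = (Nat.card L : ℚ)⁻¹) :
    (kerCard f U - Nat.card U * c) * (kerCard f U - Nat.card F * (Nat.card U * c)) =
      (Nat.card U * c) ^ 2 * (((Nat.card F : ℚ) ^ defect f U - 1) *
        ((Nat.card F : ℚ) ^ defect f U - Nat.card F)) := by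
  rw [kerCard_eq, hc]
  ring

/-- A scattered subspace has dimension at most half of that of the ambient space. -/
theorem IsScatteredTuple.two_mul_finrank_le {t : ℕ} {U : Fin t → Submodule F V}
    (h : IsScatteredTuple L U) (hm : 2 ≤ finrank F L) (i : Fin t) :
    2 * finrank F (U i) ≤ finrank F L * finrank L V := by
  classical
  have := finite_scalars F L
  have := finite_space F L V
  have := finite_space F L (Dual L V)
  have : Fintype (Dual L V) := Fintype.ofFinite _
  have hq := one_lt_natCard_cast F
  set c : ℚ := (Nat.card L : ℚ)⁻¹ with hc
  have hqc : (Nat.card F : ℚ) * c < 1 := natCard_mul_inv_lt_one hm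
  have hc0 : 0 < c := inv_pos.2 (by exact_mod_cast Nat.card_pos)
  have h1 := h.sum_self i hc
  have h2 : 0 ≤ ∑ f ∈ Finset.univ.erase (0 : Dual L V), (kerCard f (U i) - Nat.card (U i) * c) *
      (kerCard f (U i) - Nat.card F * (Nat.card (U i) * c)) := by
    refine Finset.sum_nonneg fun f _ => ?_
    rw [self_term_eq f _ hc]
    exact mul_nonneg (sq_nonneg _) (pow_sub_one_mul_pow_sub_nonneg hq _)
  rw [h1] at h2
  -- Since `m ≥ 2`, the second factor is positive, so the sign of the sum is that of `Q ^ k - |U i|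
  -- ^ 2`.
  have h3 : 0 < (1 - c) * (1 - Nat.card F * c) :=
    mul_pos (by nlinarith) (by linarith)
  have h4 := nonneg_of_mul_nonneg_right h2 h3
  have h5 : (Nat.card F : ℚ) ^ (2 * finrank F (U i)) ≤
      (Nat.card F : ℚ) ^ (finrank F L * finrank L V) := by
    have : FiniteDimensional F V := Module.Finite.trans L V
    rw [Module.natCard_eq_pow_finrank (K := F) (V := U i),
      Module.natCard_eq_pow_finrank (K := F) (V := L), Nat.cast_pow, Nat.cast_pow,
      ← pow_mul, ← pow_mul'] at h4
    linarith
  exact (pow_le_pow_iff_right₀ hq).1 h5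

theorem natCard_mul_natCard_eq {U U' : Submodule F V}
    (hU : 2 * finrank F U = finrank F L * finrank L V)
    (hU' : 2 * finrank F U' = finrank F L * finrank L V) :
    (Nat.card U * Nat.card U' : ℚ) = (Nat.card L : ℚ) ^ finrank L V := by
  have := finite_scalars F L
  have : FiniteDimensional F V := Module.Finite.trans L V
  rw [Module.natCard_eq_pow_finrank (K := F) (V := U),
    Module.natCard_eq_pow_finrank (K := F) (V := U'),
    Module.natCard_eq_pow_finrank (K := F) (V := L)]
  push_cast
  rw [← pow_add, ← pow_mul]
  congr 1
  omega

/-- In half dimension the nonnegative sum of `sum_self` is zero, so each term vanishes, while defect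
at least 2 would make its term positive. -/
theorem IsScatteredTuple.defect_le_one {t : ℕ} {U : Fin t → Submodule F V}
    (h : IsScatteredTuple L U)
    {i : Fin t} (hU : 2 * finrank F (U i) = finrank F L * finrank L V)
    {f : Dual L V} (hf : f ≠ 0) : defect f (U i) ≤ 1 := by
  classical
  have := finite_scalars F L
  have := finite_space F L V
  have := finite_space F L (Dual L V)
  have : Fintype (Dual L V) := Fintype.ofFinite _
  have hq := one_lt_natCard_cast F
  set c : ℚ := (Nat.card L : ℚ)⁻¹ with hc
  have hc0 : 0 < c := inv_pos.2 (by exact_mod_cast Nat.card_pos)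
  have hN : (0 : ℚ) < Nat.card (U i) := by exact_mod_cast Nat.card_pos
  have h1 := h.sum_self i hc
  rw [sq (Nat.card (U i) : ℚ), natCard_mul_natCard_eq hU hU, sub_self, mul_zero,
    Finset.sum_eq_zero_iff_of_nonneg] at h1
  · have h2 := h1 f (Finset.mem_erase.2 ⟨hf, Finset.mem_univ _⟩)
    rw [self_term_eq f _ hc] at h2
    by_contra! hd
    have h3 : (Nat.card F : ℚ) ^ 1 < (Nat.card F : ℚ) ^ defect f (U i) :=
      pow_lt_pow_right₀ hq hd
    rw [pow_one] at h3
    have : 0 < (Nat.card (U i) * c) ^ 2 * (((Nat.card F : ℚ) ^ defect f (U i) - 1) *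
        ((Nat.card F : ℚ) ^ defect f (U i) - Nat.card F)) :=
      mul_pos (by positivity) (mul_pos (by linarith) (by linarith))
    exact this.ne' h2
  · intro f _
    rw [self_term_eq f _ hc]
    exact mul_nonneg (sq_nonneg _) (pow_sub_one_mul_pow_sub_nonneg hq _)

/-- In half dimension the cross sum is zero and its terms are nonnegative, so in each product one
factor vanishes. -/
theorem IsScatteredTuple.defect_eq_zero_or {t : ℕ} {U : Fin t → Submodule F V}
    (h : IsScatteredTuple L U) {i j : Fin t} (hij : i ≠ j)
    (hi : 2 * finrank F (U i) = finrank F L * finrank L V)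
    (hj : 2 * finrank F (U j) = finrank F L * finrank L V)
    {f : Dual L V} (hf : f ≠ 0) : defect f (U i) = 0 ∨ defect f (U j) = 0 := by
  classical
  have := finite_scalars F L
  have := finite_space F L V
  have := finite_space F L (Dual L V)
  have : Fintype (Dual L V) := Fintype.ofFinite _
  have hq := one_lt_natCard_cast F
  set c : ℚ := (Nat.card L : ℚ)⁻¹ with hc
  have hc0 : 0 < c := inv_pos.2 (by exact_mod_cast Nat.card_pos)
  have hterm : ∀ (l : Fin t) (g : Dual L V), kerCard g (U l) - Nat.card (U l) * c =
      Nat.card (U l) * c * ((Nat.card F : ℚ) ^ defect g (U l) - 1) := by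
    intro l g
    rw [kerCard_eq, hc]
    ring
  have hN : ∀ l, (0 : ℚ) < Nat.card (U l) := fun l => by exact_mod_cast Nat.card_pos
  have hnonneg : ∀ (l : Fin t) (g : Dual L V), 0 ≤ kerCard g (U l) - Nat.card (U l) * c := by
    intro l g
    rw [hterm]
    exact mul_nonneg (mul_pos (hN l) hc0).le (sub_nonneg.2 (one_le_pow₀ hq.le))
  have h1 := h.sum_cross hij hc
  rw [natCard_mul_natCard_eq hi hj, sub_self, mul_zero, Finset.sum_eq_zero_iff_of_nonneg
    fun g _ => mul_nonneg (hnonneg i g) (hnonneg j g)] at h1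
  have h2 := h1 f (Finset.mem_erase.2 ⟨hf, Finset.mem_univ _⟩)
  have hzero : ∀ l, kerCard f (U l) - Nat.card (U l) * c = 0 → defect f (U l) = 0 := by
    intro l hl
    rw [hterm] at hl
    by_contra hd
    exact (mul_pos (mul_pos (hN l) hc0) (sub_pos.2 (one_lt_pow₀ hq hd))).ne' hl
  exact (mul_eq_zero.1 h2).imp (hzero i) (hzero j)

theorem sum_le_one_of_pairwise {t : ℕ} {d : Fin t → ℕ} (h1 : ∀ i, d i ≤ 1)
    (h2 : ∀ i j, i ≠ j → d i = 0 ∨ d j = 0) : ∑ i, d i ≤ 1 := by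
  by_cases h : ∃ i, d i ≠ 0
  · obtain ⟨i, hi⟩ := h
    rw [Finset.sum_eq_single i (fun j _ hj => (h2 i j hj.symm).resolve_left hi) (by simp)]
    exact h1 i
  · push Not at h
    simp [h]

/-- For a scattered tuple of subspaces of half dimension, every hyperplane meets at most one
member in more than the expected dimension, and then the excess is one. -/
theorem IsScatteredTuple.sum_defect_le_one {t : ℕ} {U : Fin t → Submodule F V}
    (h : IsScatteredTuple L U) (hU : ∀ i, 2 * finrank F (U i) = finrank F L * finrank L V)
    {f : Dual L V} (hf : f ≠ 0) : ∑ i, defect f (U i) ≤ 1 :=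
  sum_le_one_of_pairwise (fun i => h.defect_le_one (hU i) hf)
    fun i j hij => h.defect_eq_zero_or hij (hU i) (hU j) hf

theorem isMaximumDesign_one_iff {t : ℕ} {U : Fin t → Submodule F V} :
    IsMaximumDesign F L 1 U ↔ 2 ≤ finrank F L ∧ IsScatteredTuple L U ∧
      1 ≤ finrank L (spanOver F L U) ∧
      ∀ i, 2 * finrank F (U i) = finrank F L * finrank L V := by
  constructor
  · rintro ⟨⟨h1, h2⟩, h3, h4⟩
    refine ⟨h3, h2, h1, ?_⟩
    -- Only the total dimension is prescribed; as each member obeys the half-dimension bound,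
    -- equality of the sums forces equality for each member.
    have h5 : ∑ i, 2 * finrank F (U i) = ∑ _i : Fin t, finrank F L * finrank L V := by
      rw [← Finset.mul_sum, Finset.sum_const, Finset.card_univ, Fintype.card_fin, smul_eq_mul]
      have : (((2 * ∑ i, finrank F (U i) : ℕ)) : ℚ) =
          ((t * (finrank F L * finrank L V) : ℕ) : ℚ) := by
        rw [Nat.cast_mul, h4]
        push_cast
        ring
      exact_mod_cast this
    intro i
    exact (Finset.sum_eq_sum_iff_of_le
      fun i _ => IsScatteredTuple.two_mul_finrank_le (U := U) h2 h3 i).1 h5 i (Finset.mem_univ i)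
  · rintro ⟨h3, h2, h1, h4⟩
    refine ⟨⟨h1, h2⟩, h3, ?_⟩
    have h5 : 2 * ∑ i, finrank F (U i) = t * (finrank F L * finrank L V) := by
      rw [Finset.mul_sum, Finset.sum_congr rfl fun i _ => h4 i]
      simp
    have h6 : (2 : ℚ) * ((∑ i, finrank F (U i) : ℕ) : ℚ) =
        t * (finrank F L * finrank L V) := by exact_mod_cast h5
    push_cast at h6 ⊢
    linarith

end Scattered

/-! ### Trace duality and part (a). -/

section Dual
variable {F L V : Type*} [Field F] [Finite F] [Field L] [Algebra F L] [FiniteDimensional F L]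

/-- The trace is `∑ x ^ (q ^ i)`, so it commutes with `θ` even when `θ` moves elements of `F`. -/
theorem trace_ringHom_eq_zero_iff (θ : L →+* L) (x : L) :
    Algebra.trace F L (θ x) = 0 ↔ Algebra.trace F L x = 0 := by
  have := finite_scalars F L
  have : Fintype F := Fintype.ofFinite F
  have h : algebraMap F L (Algebra.trace F L (θ x)) = θ (algebraMap F L (Algebra.trace F L x)) := by
    rw [FiniteField.algebraMap_trace_eq_sum_pow, FiniteField.algebraMap_trace_eq_sum_pow, map_sum]
    simp only [map_pow]
  rw [← map_eq_zero (algebraMap F L), h, map_eq_zero θ, map_eq_zero (algebraMap F L)]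

/-- A bijection onto the dual space counts the annihilator of a subspace. -/
theorem natCard_preimage_dualAnnihilator {X Y : Type*} [AddCommGroup X] [Module F X]
    [FiniteDimensional F X] [AddCommGroup Y] (Ψ : Y →+ Dual F X) (hΨ : Function.Injective Ψ)
    (hY : Nat.card Y = Nat.card X) (S : Submodule F X) :
    Nat.card {y // Ψ y ∈ S.dualAnnihilator} = Nat.card F ^ (finrank F X - finrank F S) := by
  have : Finite (Dual F X) := Module.finite_of_finite F
  have : Finite Y := Finite.of_injective Ψ hΨ
  have hcard : Nat.card Y = Nat.card (Dual F X) := by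
    rw [hY, Module.natCard_eq_pow_finrank (K := F) (V := X),
      Module.natCard_eq_pow_finrank (K := F) (V := Dual F X), Subspace.dual_finrank_eq]
  have hbij : Function.Bijective Ψ := (Nat.bijective_iff_injective_and_card Ψ).2 ⟨hΨ, hcard⟩
  have h1 : finrank F S.dualAnnihilator = finrank F X - finrank F S := by
    have := Subspace.finrank_add_finrank_dualAnnihilator_eq S
    omega
  rw [← h1, ← Module.natCard_eq_pow_finrank (K := F) (V := S.dualAnnihilator)]
  exact Nat.card_congr ((Equiv.ofBijective Ψ hbij).subtypeEquiv fun y => Iff.rfl)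

theorem finrank_eq_of_natCard_eq {X : Type*} [AddCommGroup X] [Module F X]
    [FiniteDimensional F X] {n : ℕ} (h : Nat.card X = Nat.card F ^ n) : finrank F X = n := by
  rw [Module.natCard_eq_pow_finrank (K := F)] at h
  exact Nat.pow_right_injective (Finite.one_lt_card (α := F)) h

variable [AddCommGroup V] [Module F V] [Module L V] [IsScalarTower F L V]

theorem exists_trace_ne_zero {f : Dual L V} (hf : f ≠ 0) :
    ∃ v, Algebra.trace F L (f v) ≠ 0 := by
  have := finite_scalars F L
  obtain ⟨x, hx⟩ := Algebra.trace_surjective F L 1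
  obtain ⟨v, hv⟩ : ∃ v, f v ≠ 0 := by
    by_contra! h
    exact hf (LinearMap.ext h)
  refine ⟨(x / f v) • v, ?_⟩
  rw [map_smul, smul_eq_mul, div_mul_cancel₀ _ hv, hx]
  exact one_ne_zero

/-- A ring endomorphism of a finite field, as an automorphism. -/
noncomputable def frobeniusEquiv (F : Type*) {L : Type*} [Field F] [Finite F] [Field L]
    [Algebra F L] [FiniteDimensional F L] (θ : L →+* L) : L ≃+* L :=
  have := finite_scalars F L
  RingEquiv.ofBijective θ ⟨θ.injective, Finite.surjective_of_injective θ.injective⟩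

variable (F) in
/-- The linear functional `θ⁻¹ ∘ σ(v, ·)`. -/
noncomputable def untwist {θ : L →+* L} (σ : V →ₗ[L] V →ₛₗ[θ] L) (v : V) : Dual L V where
  toFun u := (frobeniusEquiv F θ).symm (σ v u)
  map_add' x y := by simp
  map_smul' c x := by
    have : θ c = frobeniusEquiv F θ c := rfl
    simp [this]

theorem apply_untwist {θ : L →+* L} (σ : V →ₗ[L] V →ₛₗ[θ] L) (v u : V) :
    θ (untwist F σ v u) = σ v u := (frobeniusEquiv F θ).apply_symm_apply (σ v u)

/-- Replaces the semilinear `σ v` by an honest linear functional, to which defects apply. -/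
theorem mem_traceDual_iff {θ : L →+* L} (σ : V →ₗ[L] V →ₛₗ[θ] L) (U : Submodule F V) (v : V) :
    v ∈ traceDual σ U ↔ ∀ u ∈ U, Algebra.trace F L (untwist F σ v u) = 0 := by
  change (∀ u ∈ U, Algebra.trace F L (σ v u) = 0) ↔ _
  simp only [← apply_untwist (F := F) σ, trace_ringHom_eq_zero_iff]

theorem untwist_add {θ : L →+* L} (σ : V →ₗ[L] V →ₛₗ[θ] L) (v w : V) :
    untwist F σ (v + w) = untwist F σ v + untwist F σ w := by
  ext u
  simp [untwist]

theorem untwist_ne_zero {θ : L →+* L} {σ : V →ₗ[L] V →ₛₗ[θ] L} (hσ : σ.SeparatingLeft) {v : V}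
    (hv : v ≠ 0) : untwist F σ v ≠ 0 := by
  intro h
  refine hv (hσ v fun u => ?_)
  rw [← apply_untwist (F := F), h, LinearMap.zero_apply, map_zero]

variable [FiniteDimensional L V]

/-- The map `Ψ` need not be `F`-linear, since `θ` may act on `F`; the dimension is therefore read
off from a cardinality. -/
theorem finrank_traceDual {θ : L →+* L} {σ : V →ₗ[L] V →ₛₗ[θ] L} (hσ : σ.SeparatingLeft)
    (U : Submodule F V) :
    finrank F (traceDual σ U) = finrank F V - finrank F U := by
  have : FiniteDimensional F V := Module.Finite.trans L V
  let Ψ : V →+ Dual F V := AddMonoidHom.mk'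
    (fun v => (Algebra.trace F L) ∘ₗ ((untwist F σ v).restrictScalars F)) (by
      intro v w
      ext u
      simp [untwist_add])
  have hΨ : Function.Injective Ψ := by
    rw [injective_iff_map_eq_zero]
    intro v hv
    by_contra h0
    obtain ⟨u, hu⟩ := exists_trace_ne_zero (F := F) (untwist_ne_zero (F := F) hσ h0)
    exact hu (LinearMap.congr_fun hv u)
  apply finrank_eq_of_natCard_eq
  rw [← natCard_preimage_dualAnnihilator Ψ hΨ rfl U]
  refine Nat.card_congr (Equiv.subtypeEquivRight fun v => ?_)
  rw [mem_traceDual_iff, Submodule.mem_dualAnnihilator]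
  rfl

/-- `c • v` lies in the dual exactly when `θ⁻¹ c` is trace-orthogonal to the image of `U` in `L`,
and that orthogonal space has dimension `m - dim` of the image. -/
theorem finrank_traceDual_inf_span {θ : L →+* L} {σ : V →ₗ[L] V →ₛₗ[θ] L}
    (U : Submodule F V) {v : V} (hv : v ≠ 0) :
    finrank F (traceDual σ U ⊓ (Submodule.span L {v}).restrictScalars F : Submodule F V) =
      defect (untwist F σ v) U := by
  have : FiniteDimensional F V := Module.Finite.trans L V
  let e := frobeniusEquiv F θ
  let Ψ : L →+ Dual F L := AddMonoidHom.mk'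
    (fun c => (Algebra.trace F L) ∘ₗ (LinearMap.mulLeft F (e.symm c))) (by
      intro c d
      ext x
      simp [add_mul])
  have hΨ : Function.Injective Ψ := by
    rw [injective_iff_map_eq_zero]
    intro c hc
    by_contra h0
    have hf : LinearMap.mulLeft L (e.symm c) ≠ 0 := by
      rw [Ne, LinearMap.mulLeft_eq_zero_iff]
      simpa using h0
    obtain ⟨x, hx⟩ := exists_trace_ne_zero (F := F) hf
    exact hx (LinearMap.congr_fun hc x)
  apply finrank_eq_of_natCard_eq
  rw [defect, ← natCard_preimage_dualAnnihilator Ψ hΨ rfl (evalImage (untwist F σ v) U)]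
  have hmem : ∀ c : L, c • v ∈ traceDual σ U ↔
      Ψ c ∈ (evalImage (untwist F σ v) U).dualAnnihilator := by
    intro c
    rw [mem_traceDual_iff, Submodule.mem_dualAnnihilator]
    simp only [evalImage, Submodule.mem_map, forall_exists_index, and_imp,
      forall_apply_eq_imp_iff₂]
    refine forall₂_congr fun u _ => ?_
    have : untwist F σ (c • v) u = e.symm c * untwist F σ v u := by
      simp [untwist, e]
    rw [this]
    rfl
  symm
  refine Nat.card_congr (Equiv.ofBijective
    (fun c : {c // Ψ c ∈ (evalImage (untwist F σ v) U).dualAnnihilator} =>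
      (⟨(c : L) • v, (hmem c).2 c.2,
        Submodule.smul_mem _ _ (Submodule.mem_span_singleton_self v)⟩ :
        (traceDual σ U ⊓ (Submodule.span L {v}).restrictScalars F : Submodule F V))) ⟨?_, ?_⟩)
  · intro c d hcd
    exact Subtype.ext (smul_left_injective L hv (Subtype.ext_iff.1 hcd))
  · rintro ⟨w, hw1, hw2⟩
    obtain ⟨c, rfl⟩ := Submodule.mem_span_singleton.1 hw2
    exact ⟨⟨c, (hmem c).1 hw1⟩, rfl⟩

/-- Duality: the dual tuple is scattered exactly when every hyperplane meets at most one member of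
the original tuple in more than the expected dimension, and then the excess is one. -/
theorem isScatteredTuple_traceDual_iff {θ : L →+* L} {σ : V →ₗ[L] V →ₛₗ[θ] L}
    {t : ℕ} (U : Fin t → Submodule F V) :
    IsScatteredTuple L (fun i => traceDual σ (U i)) ↔
      ∀ v : V, v ≠ 0 → ∑ i, defect (untwist F σ v) (U i) ≤ 1 := by
  constructor
  · intro h v hv
    have := h _ (finrank_span_singleton hv)
    simpa only [finrank_traceDual_inf_span _ hv] using this
  · intro h W hW
    obtain ⟨v, hv, rfl⟩ : ∃ v : V, v ≠ 0 ∧ Submodule.span L {v} = W := by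
      obtain ⟨v, hv, h1⟩ := finrank_eq_one_iff'.1 hW
      refine ⟨v, by simpa using hv, le_antisymm ?_ fun w hw => ?_⟩
      · rw [Submodule.span_singleton_le_iff_mem]
        exact v.2
      · obtain ⟨c, hc⟩ := h1 ⟨w, hw⟩
        exact Submodule.mem_span_singleton.2 ⟨c, congrArg Subtype.val hc⟩
    simpa only [finrank_traceDual_inf_span _ hv] using h v hv

theorem two_mul_finrank_traceDual {θ : L →+* L} {σ : V →ₗ[L] V →ₛₗ[θ] L}
    (hσ : σ.SeparatingLeft) {U : Submodule F V}
    (hU : 2 * finrank F U = finrank F L * finrank L V) :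
    2 * finrank F (traceDual σ U) = finrank F L * finrank L V := by
  rw [finrank_traceDual hσ, ← finrank_mul_finrank F L V]
  omega

theorem one_le_finrank_spanOver {t : ℕ} {U : Fin t → Submodule F V} (i : Fin t)
    (h : 1 ≤ finrank F (U i)) : 1 ≤ finrank L (spanOver F L U) := by
  have : FiniteDimensional F V := Module.Finite.trans L V
  rw [Submodule.one_le_finrank_iff] at h ⊢
  obtain ⟨u, hu, h0⟩ := (Submodule.ne_bot_iff _).1 h
  exact (Submodule.ne_bot_iff _).2
    ⟨u, Submodule.subset_span (Set.mem_iUnion.2 ⟨i, hu⟩), h0⟩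

theorem exists_index_of_finrank_spanOver {t : ℕ} {U : Fin t → Submodule F V}
    (h : 1 ≤ finrank L (spanOver F L U)) : ∃ i, 1 ≤ finrank F (U i) := by
  have : FiniteDimensional F V := Module.Finite.trans L V
  by_contra! h0
  rw [Submodule.one_le_finrank_iff] at h
  refine h ?_
  rw [spanOver, Submodule.span_eq_bot]
  intro x hx
  obtain ⟨i, hi⟩ := Set.mem_iUnion.1 hx
  have := h0 i
  rw [Nat.lt_one_iff, Submodule.finrank_eq_zero] at this
  rw [this] at hi
  exact hi

/-- The dual of a maximum `1`-design is a maximum `1`-design. -/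
theorem IsMaximumDesign.traceDual {t : ℕ} {U : Fin t → Submodule F V}
    (h : IsMaximumDesign F L 1 U) {θ : L →+* L} {σ : V →ₗ[L] V →ₛₗ[θ] L}
    (hσ : σ.SeparatingLeft) : IsMaximumDesign F L 1 (fun i => traceDual σ (U i)) := by
  rw [isMaximumDesign_one_iff] at h ⊢
  obtain ⟨h1, h2, h3, h4⟩ := h
  refine ⟨h1, ?_, ?_, fun i => two_mul_finrank_traceDual hσ (h4 i)⟩
  · rw [isScatteredTuple_traceDual_iff]
    exact fun v hv => h2.sum_defect_le_one h4 (untwist_ne_zero hσ hv)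
  -- The span condition excludes an empty tuple and zero members; the dual of a nonzero
  -- half-dimensional member is again nonzero.
  · obtain ⟨i, hi⟩ := exists_index_of_finrank_spanOver h3
    refine one_le_finrank_spanOver i ?_
    have := two_mul_finrank_traceDual hσ (h4 i)
    have := h4 i
    change 1 ≤ finrank F (SubspaceDesign.traceDual σ (U i))
    omega

end Dual

/-! ### The hyperplane condition and part (b). -/

section Hyperplanes
variable {F L V : Type*} [Field F] [Finite F] [Field L] [Algebra F L] [FiniteDimensional F L]
  [AddCommGroup V] [Module F V] [Module L V] [IsScalarTower F L V] [FiniteDimensional L V]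

theorem untwist_id (σ : V →ₗ[L] V →ₗ[L] L) (v : V) : untwist F σ v = σ v := by
  ext u
  exact apply_untwist (F := F) σ v u

theorem traceDual_traceDual {σ : V →ₗ[L] V →ₗ[L] L} (hσ : σ.SeparatingLeft)
    (hs : ∀ x y, σ x y = σ y x) (U : Submodule F V) : traceDual σ (traceDual σ U) = U := by
  have : FiniteDimensional F V := Module.Finite.trans L V
  symm
  refine Submodule.eq_of_le_of_finrank_eq (fun u hu v hv => ?_) ?_
  · rw [hs]
    exact hv u hu
  · have := Submodule.finrank_le U
    rw [finrank_traceDual hσ, finrank_traceDual hσ]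
    omega

/-- For half-dimensional subspaces, being scattered is equivalent to the condition on
hyperplanes. -/
theorem isScatteredTuple_iff {σ : V →ₗ[L] V →ₗ[L] L} (hσ : σ.SeparatingLeft)
    (hs : ∀ x y, σ x y = σ y x) {t : ℕ} {U : Fin t → Submodule F V}
    (hU : ∀ i, 2 * finrank F (U i) = finrank F L * finrank L V) :
    IsScatteredTuple L U ↔ ∀ f : Dual L V, f ≠ 0 → ∑ i, defect f (U i) ≤ 1 := by
  refine ⟨fun h f hf => h.sum_defect_le_one hU hf, fun h => ?_⟩
  have h1 : IsScatteredTuple L (fun i => traceDual σ (U i)) :=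
    (isScatteredTuple_traceDual_iff U).2 fun v hv => h _ (untwist_ne_zero hσ hv)
  -- The dual tuple is scattered and half-dimensional, so the counting argument applies to it and
  -- makes the double dual, which is `U`, scattered.
  have h2 : IsScatteredTuple L (fun i => traceDual σ (traceDual σ (U i))) :=
    (isScatteredTuple_traceDual_iff _).2 fun v hv =>
      h1.sum_defect_le_one (fun i => two_mul_finrank_traceDual hσ (hU i)) (untwist_ne_zero hσ hv)
  simpa only [traceDual_traceDual hσ hs] using h2

theorem finrank_inf_ker_add (U : Submodule F V) (f : Dual L V) :
    finrank F (U ⊓ (LinearMap.ker f).restrictScalars F : Submodule F V) + finrank F L =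
      finrank F U + defect f U := by
  have : FiniteDimensional F V := Module.Finite.trans L V
  let g : U →ₗ[F] L := (f.restrictScalars F).domRestrict U
  have h1 := g.finrank_range_add_finrank_ker
  have h2 : LinearMap.range g = evalImage f U := by
    simp [g, evalImage, LinearMap.range_domRestrict]
  have h3 := finrank_evalImage_add_defect f U
  have h4 : (LinearMap.ker g).map U.subtype =
      (U ⊓ (LinearMap.ker f).restrictScalars F : Submodule F V) := by
    ext x
    simp [g, and_comm]
  have h5 : finrank F ((LinearMap.ker g).map U.subtype) = finrank F (LinearMap.ker g) :=
    (Submodule.equivMapOfInjective _ U.injective_subtype _).finrank_eq.symm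
  rw [h2] at h1
  rw [h4] at h5
  omega

theorem sum_finrank_inf_ker_add {t n : ℕ} {U : Fin t → Submodule F V}
    (hU : ∀ i, finrank F (U i) = n) (f : Dual L V) :
    ∑ i, finrank F (U i ⊓ (LinearMap.ker f).restrictScalars F : Submodule F V) +
      t * finrank F L = t * n + ∑ i, defect f (U i) := by
  have h := Finset.sum_congr rfl fun i (_ : i ∈ Finset.univ) => finrank_inf_ker_add (U i) f
  simpa [Finset.sum_add_distrib, hU] using h

theorem exists_ker_eq {W : Submodule L V} (hW : finrank L W + 1 = finrank L V) :
    ∃ f : Dual L V, f ≠ 0 ∧ LinearMap.ker f = W := by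
  have hlt : W < ⊤ := by
    refine lt_top_iff_ne_top.2 ?_
    rintro rfl
    rw [finrank_top] at hW
    omega
  obtain ⟨f, hf, hle⟩ := Submodule.exists_le_ker_of_lt_top W hlt
  refine ⟨f, hf, (Submodule.eq_of_le_of_finrank_eq hle ?_).symm⟩
  have := Module.Dual.finrank_ker_add_one_of_ne_zero hf
  omega

/-- A nonzero functional killing the span would have defect `m ≥ 2` on every member. -/
theorem spanOver_eq_top {t : ℕ} {U : Fin t → Submodule F V} (hm : 2 ≤ finrank F L) (i : Fin t)
    (h : ∀ f : Dual L V, f ≠ 0 → ∑ i, defect f (U i) ≤ 1) : spanOver F L U = ⊤ := by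
  by_contra hne
  obtain ⟨f, hf, hle⟩ := Submodule.exists_le_ker_of_lt_top _ (lt_top_iff_ne_top.2 hne)
  have h1 : evalImage f (U i) = ⊥ := by
    rw [evalImage, eq_bot_iff, Submodule.map_le_iff_le_comap]
    exact fun u hu => hle (Submodule.subset_span (Set.mem_iUnion.2 ⟨i, hu⟩))
  have h2 : defect f (U i) = finrank F L := by rw [defect, h1, finrank_bot, Nat.sub_zero]
  have h3 := (Finset.single_le_sum (f := fun i => defect f (U i)) (fun _ _ => Nat.zero_le _)
    (Finset.mem_univ i)).trans (h f hf)
  simp only [h2] at h3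
  omega

theorem isSubspaceDesign_iff {t n : ℕ} {U : Fin t → Submodule F V} (hm : 2 ≤ finrank F L)
    (hk : 2 ≤ finrank L V) (hU : ∀ i, finrank F (U i) = n)
    (hn : finrank F L * finrank L V = 2 * n) :
    IsSubspaceDesign F L (finrank L V - 1) (t * finrank F L * (finrank L V - 2) / 2 + 1) U ↔
      1 ≤ finrank L (spanOver F L U) ∧ ∀ f : Dual L V, f ≠ 0 → ∑ i, defect f (U i) ≤ 1 := by
  -- The natural-number division is exact: `t * m * (k - 2) = 2 * (t * n - t * m)` because `m * k =
  -- 2 * n`.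
  have hA : t * finrank F L * (finrank L V - 2) / 2 + t * finrank F L = t * n := by
    obtain ⟨k, hk'⟩ := Nat.exists_eq_add_of_le hk
    have h1 : t * finrank F L * (finrank L V - 2) + 2 * (t * finrank F L) = 2 * (t * n) := by
      rw [hk'] at hn ⊢
      rw [Nat.add_sub_cancel_left]
      linear_combination t * hn
    omega
  have hiff : ∀ f : Dual L V,
      ∑ i, finrank F (U i ⊓ (LinearMap.ker f).restrictScalars F : Submodule F V) ≤
        t * finrank F L * (finrank L V - 2) / 2 + 1 ↔ ∑ i, defect f (U i) ≤ 1 := by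
    intro f
    have := sum_finrank_inf_ker_add hU f
    omega
  have h2 : (∀ W : Submodule L V, finrank L W = finrank L V - 1 →
      ∑ i, finrank F (U i ⊓ W.restrictScalars F : Submodule F V) ≤
        t * finrank F L * (finrank L V - 2) / 2 + 1) ↔
      ∀ f : Dual L V, f ≠ 0 → ∑ i, defect f (U i) ≤ 1 := by
    constructor
    · intro h f hf
      refine (hiff f).1 (h _ ?_)
      have := Module.Dual.finrank_ker_add_one_of_ne_zero hf
      omega
    · intro h W hW
      obtain ⟨f, hf, rfl⟩ := exists_ker_eq (W := W) (by omega)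
      exact (hiff f).2 (h f hf)
  rw [IsSubspaceDesign, h2]
  -- The span bounds `k - 1` and `1` agree here: `k ≥ 2` gives one direction, and the hyperplane
  -- condition makes a nonempty tuple span `V`.
  refine and_congr_left fun h => ⟨fun h1 => by omega, fun h1 => ?_⟩
  obtain ⟨i, -⟩ := exists_index_of_finrank_spanOver h1
  rw [spanOver_eq_top hm i h, finrank_top]
  omega

end Hyperplanes

/-! ### The dot product as a symmetric form on `L^k`. -/

section DotProduct
variable {F L : Type*} [Field F] [Finite F] [Field L] [Algebra F L] [FiniteDimensional F L]
variable {k : ℕ}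

/-- The standard bilinear form on `L^k`. -/
noncomputable def dotForm (L : Type*) [Field L] (k : ℕ) : (Fin k → L) →ₗ[L] (Fin k → L) →ₗ[L] L :=
  (dotProductEquiv L (Fin k)).toLinearMap

theorem dotForm_apply (x y : Fin k → L) : dotForm L k x y = x ⬝ᵥ y := rfl

theorem dotForm_comm (x y : Fin k → L) : dotForm L k x y = dotForm L k y x :=
  dotProduct_comm x y

theorem dotForm_separatingLeft : (dotForm L k).SeparatingLeft := by
  intro x hx
  exact (dotProductEquiv L (Fin k)).map_eq_zero_iff.1 (LinearMap.ext hx)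

theorem exists_dotForm_eq (f : Dual L (Fin k → L)) : ∃ x, dotForm L k x = f :=
  (dotProductEquiv L (Fin k)).surjective f

theorem isMaximumDesign_iff_defect {t n : ℕ} {U : Fin t → Submodule F (Fin k → L)}
    (hm : 2 ≤ finrank F L) (hU : ∀ i, finrank F (U i) = n) (hn : finrank F L * k = 2 * n) :
    IsMaximumDesign F L 1 U ↔ 1 ≤ finrank L (spanOver F L U) ∧
      ∀ f : Dual L (Fin k → L), f ≠ 0 → ∑ i, defect f (U i) ≤ 1 := by
  have hU' : ∀ i, 2 * finrank F (U i) = finrank F L * finrank L (Fin k → L) := by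
    intro i
    rw [hU, finrank_fin_fun, hn]
  rw [isMaximumDesign_one_iff, isScatteredTuple_iff dotForm_separatingLeft dotForm_comm hU']
  tauto

end DotProduct

/-! ### Weights of associated codes and part (c). -/

section Codes
variable {F L : Type*} [Field F] [Finite F] [Field L] [Algebra F L] [FiniteDimensional F L]
variable {k t : ℕ} {n : Fin t → ℕ}

/-- The encoding map of the generator matrix `(G_1 | ⋯ | G_t)`. -/
noncomputable def encode (G : ∀ i, Matrix (Fin k) (Fin (n i)) L) :
    (Fin k → L) →ₗ[L] (∀ i, Fin (n i) → L) :=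
  Fintype.linearCombination L (fun (r : Fin k) (i : Fin t) (c : Fin (n i)) => G i r c)

theorem range_encode (G : ∀ i, Matrix (Fin k) (Fin (n i)) L) :
    LinearMap.range (encode G) = codeOfMatrix G :=
  Fintype.range_linearCombination L _

theorem encode_apply (G : ∀ i, Matrix (Fin k) (Fin (n i)) L) (a : Fin k → L) (i : Fin t)
    (c : Fin (n i)) : encode G a i c = dotForm L k a (fun r => G i r c) := by
  simp [encode, Fintype.linearCombination_apply, dotForm_apply, dotProduct]

/-- The entries of block `i` are the values of the functional of `a` on generators of `U i`, so
their `F`-span is the image of `U i`. -/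
theorem rankWeight_encode {U : Fin t → Submodule F (Fin k → L)}
    {G : ∀ i, Matrix (Fin k) (Fin (n i)) L}
    (hG : ∀ i, Submodule.span F (Set.range fun c r => G i r c) = U i) (a : Fin k → L)
    (i : Fin t) :
    rankWeight F (encode G a i) = finrank F (evalImage (dotForm L k a) (U i)) := by
  rw [rankWeight, evalImage, ← hG i, Submodule.map_span, ← Set.range_comp]
  exact congrArg (fun v : Fin (n i) → L => finrank F (Submodule.span F (Set.range v)))
    (funext fun c => encode_apply G a i c)

theorem sumRankWeight_encode_add {U : Fin t → Submodule F (Fin k → L)}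
    {G : ∀ i, Matrix (Fin k) (Fin (n i)) L}
    (hG : ∀ i, Submodule.span F (Set.range fun c r => G i r c) = U i) (a : Fin k → L) :
    sumRankWeight F (encode G a) + ∑ i, defect (dotForm L k a) (U i) = t * finrank F L := by
  rw [sumRankWeight, ← Finset.sum_add_distrib]
  simp only [rankWeight_encode hG, finrank_evalImage_add_defect]
  simp

theorem encode_injective {U : Fin t → Submodule F (Fin k → L)}
    {G : ∀ i, Matrix (Fin k) (Fin (n i)) L}
    (hG : ∀ i, Submodule.span F (Set.range fun c r => G i r c) = U i)
    (hU : spanOver F L U = ⊤) : Function.Injective (encode G) := by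
  rw [injective_iff_map_eq_zero]
  intro a ha
  refine dotForm_separatingLeft a fun x => ?_
  have hx : x ∈ spanOver F L U := hU ▸ Submodule.mem_top
  have hle : spanOver F L U ≤ LinearMap.ker (dotForm L k a) := by
    rw [spanOver, Submodule.span_le]
    refine Set.iUnion_subset fun i => ?_
    rw [← hG i]
    change Submodule.span F _ ≤ (LinearMap.ker (dotForm L k a)).restrictScalars F
    rw [Submodule.span_le]
    rintro _ ⟨c, rfl⟩
    change dotForm L k a _ = 0
    rw [← encode_apply, ha]
    rfl
  exact hle hx

/-- Every code associated with `U` is the image of an injective linear map whose weights are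
given by the defects of `U`. -/
theorem exists_encoding_of_mem_associatedCodes {U : Fin t → Submodule F (Fin k → L)}
    (hU : spanOver F L U = ⊤) {C : Submodule L (∀ i, Fin (n i) → L)}
    (hC : C ∈ associatedCodes F n U) :
    ∃ ψ : (Fin k → L) →ₗ[L] (∀ i, Fin (n i) → L), Function.Injective ψ ∧
      LinearMap.range ψ = C ∧ ∀ a, sumRankWeight F (ψ a) +
        ∑ i, defect (dotForm L k a) (U i) = t * finrank F L := by
  obtain ⟨G, hG, φ, hφ, rfl⟩ := hC
  have hG' := fun i => (hG i).2
  refine ⟨φ.toLinearMap ∘ₗ encode G, φ.injective.comp (encode_injective hG' hU), ?_, fun a => ?_⟩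
  · rw [LinearMap.range_comp, range_encode]
  · rw [LinearMap.comp_apply, LinearEquiv.coe_coe, hφ, sumRankWeight_encode_add hG']

theorem associatedCodes_nonempty {U : Fin t → Submodule F (Fin k → L)}
    (hU : ∀ i, finrank F (U i) = n i) : (associatedCodes F n U).Nonempty := by
  have : FiniteDimensional F (Fin k → L) := Module.Finite.trans L _
  let b := fun i => finBasisOfFinrankEq F (U i) (hU i)
  refine ⟨codeOfMatrix fun i r c => (b i c : Fin k → L) r, fun i r c => (b i c : Fin k → L) r,
    fun i => ⟨?_, ?_⟩, LinearEquiv.refl _ _, fun _ => rfl, Submodule.map_id _⟩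
  · exact (b i).linearIndependent.map' (U i).subtype (U i).ker_subtype
  · have h : (Set.range fun c r => (b i c : Fin k → L) r) =
        (U i).subtype '' Set.range (b i) := by
      rw [← Set.range_comp]
      rfl
    rw [h, ← Submodule.map_span, (b i).span_eq, Submodule.map_subtype_top]

theorem isMinDist_iff_of_injective {ψ : (Fin k → L) →ₗ[L] (∀ i, Fin (n i) → L)}
    (hψ : Function.Injective ψ) (d : ℕ) :
    IsMinDist F (LinearMap.range ψ) d ↔
      IsLeast {e | ∃ a : Fin k → L, a ≠ 0 ∧ sumRankWeight F (ψ a) = e} d := by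
  rw [IsMinDist]
  congr! 1
  ext e
  constructor
  · rintro ⟨_, ⟨x, rfl⟩, _, ⟨y, rfl⟩, hxy, h⟩
    refine ⟨x - y, sub_ne_zero.2 fun h0 => hxy (by rw [h0]), ?_⟩
    rw [map_sub]
    exact h
  · rintro ⟨a, ha, h⟩
    refine ⟨ψ a, ⟨a, rfl⟩, 0, zero_mem _, fun h0 => ha (hψ (h0.trans (map_zero ψ).symm)), ?_⟩
    rw [sumRankDist, sub_zero, h]

/-- Some hyperplane meets a member of a half-dimensional tuple in more than the expected
dimension. -/
theorem exists_one_le_sum_defect {N : ℕ} {U : Fin t → Submodule F (Fin k → L)} (i : Fin t)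
    (hi : finrank F (U i) = N) (hN : finrank F L * k = 2 * N) (hN0 : 0 < N) :
    ∃ a : Fin k → L, a ≠ 0 ∧ 1 ≤ ∑ i, defect (dotForm L k a) (U i) := by
  have : FiniteDimensional F (Fin k → L) := Module.Finite.trans L _
  have h1 : 2 * finrank F (traceDual (dotForm L k) (U i)) = finrank F L * k := by
    have := two_mul_finrank_traceDual (F := F) (U := U i) (dotForm_separatingLeft (L := L) (k := k))
      (by rw [hi, finrank_fin_fun, hN])
    rwa [finrank_fin_fun] at this
  have h2 : 1 ≤ finrank F (traceDual (dotForm L k) (U i)) := by omega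
  -- A nonzero `a` in the dual of `U i` spans a line meeting that dual, and the dimension of the
  -- intersection is the defect of `a` on `U i`.
  obtain ⟨a, ha, ha0⟩ := (Submodule.ne_bot_iff _).1 (Submodule.one_le_finrank_iff.1 h2)
  have h3 := one_le_finrank_inf_span (L := L) ha ha0
  rw [finrank_traceDual_inf_span (U i) ha0, untwist_id] at h3
  exact ⟨a, ha0, h3.trans (Finset.single_le_sum (f := fun i => defect (dotForm L k a) (U i))
    (fun _ _ => Nat.zero_le _) (Finset.mem_univ i))⟩

theorem isMSRD_of_isMinDist {N : ℕ} (hm : 2 ≤ finrank F L) (hk : 2 ≤ k)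
    (hN : finrank F L * k = 2 * N) (ht : 0 < t)
    {C : Submodule L (∀ _ : Fin t, Fin N → L)} (hC : finrank L C = k)
    (hd : IsMinDist F C (finrank F L * t - 1)) : IsMSRD F C := by
  have := finite_scalars F L
  have hmN : finrank F L ≤ N := by nlinarith
  -- Since `m ≤ N`, `d - 1 = mt - 2 = m (t - 1) + (m - 2)`: `j` is the last block and `δ = m - 2`.
  -- The Singleton exponent is `m N - N (m - 2) = 2 N = m k`.
  refine ⟨antitone_const, finrank F L * t - 1, ⟨t - 1, by omega⟩, finrank F L - 2, hd, ?_, ?_, ?_⟩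
  · rw [Finset.sum_const, Fin.card_Iio, min_eq_left hmN, smul_eq_mul]
    obtain ⟨s, rfl⟩ := Nat.exists_eq_add_of_lt ht
    simp only [zero_add, Nat.add_sub_cancel, mul_add, mul_one, mul_comm s]
    omega
  · rw [min_eq_left hmN]
    omega
  · rw [Finset.sum_const, Fin.card_Ici, max_eq_right hmN, smul_eq_mul,
      Module.natCard_eq_pow_finrank (K := L), hC,
      Module.natCard_eq_pow_finrank (K := F) (V := L), ← pow_mul]
    congr 1
    have h1 : t - (t - 1) = 1 := by omega
    obtain ⟨m, hm'⟩ := Nat.exists_eq_add_of_le hm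
    rw [hN, h1, hm', one_mul, Nat.add_sub_cancel_left, add_mul, mul_comm N m,
      Nat.add_sub_cancel]

/-- The associated codes are MSRD of minimum distance `m t - 1` exactly when no hyperplane meets
the members of `U` in total excess dimension more than one. -/
theorem forall_associatedCodes_isMSRD_iff {N : ℕ} (hm : 2 ≤ finrank F L) (hk : 2 ≤ k)
    (hN : finrank F L * k = 2 * N) {U : Fin t → Submodule F (Fin k → L)}
    (hU : ∀ i, finrank F (U i) = N) (hspan : spanOver F L U = ⊤) :
    (∀ C ∈ associatedCodes F (fun _ : Fin t => N) U,
      IsCode F C k (finrank F L * t - 1) ∧ IsMSRD F C) ↔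
      ∀ f : Dual L (Fin k → L), f ≠ 0 → ∑ i, defect f (U i) ≤ 1 := by
  constructor
  · intro h f hf
    obtain ⟨C, hC⟩ := associatedCodes_nonempty (n := fun _ => N) hU
    obtain ⟨ψ, hψ, rfl, hw⟩ := exists_encoding_of_mem_associatedCodes hspan hC
    have hd := (isMinDist_iff_of_injective hψ _).1 (h _ hC).1.2
    obtain ⟨a, rfl⟩ := exists_dotForm_eq f
    have ha : a ≠ 0 := by
      rintro rfl
      exact hf (map_zero _)
    have h1 := hd.2 ⟨a, ha, rfl⟩
    have h2 := hw a
    rw [mul_comm] at h2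
    omega
  · intro h C hC
    obtain ⟨ψ, hψ, rfl, hw⟩ := exists_encoding_of_mem_associatedCodes hspan hC
    have hdim : finrank L (LinearMap.range ψ) = k := by
      rw [LinearMap.finrank_range_of_inj hψ, finrank_fin_fun]
    obtain ⟨i, -⟩ : ∃ i, 1 ≤ finrank F (U i) := by
      refine exists_index_of_finrank_spanOver (L := L) ?_
      rw [hspan, finrank_top, finrank_fin_fun]
      omega
    have hdist : IsMinDist F (LinearMap.range ψ) (finrank F L * t - 1) := by
      have hle : ∀ a : Fin k → L, a ≠ 0 → ∑ i, defect (dotForm L k a) (U i) ≤ 1 := by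
        intro a ha
        refine h _ fun h0 => ha (dotForm_separatingLeft a fun x => ?_)
        rw [h0, LinearMap.zero_apply]
      rw [isMinDist_iff_of_injective hψ, mul_comm]
      constructor
      -- The defect sum is at most 1 for all `a ≠ 0`; a functional attaining 1 is needed for the
      -- distance to be `mt - 1` and not `mt`.
      · obtain ⟨a, ha, h1⟩ := exists_one_le_sum_defect i (hU i) hN (by nlinarith)
        refine ⟨a, ha, ?_⟩
        have h2 := hw a
        have h3 := hle a ha
        omega
      · rintro _ ⟨a, ha, rfl⟩
        have h2 := hw a
        have h3 := hle a ha
        omega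
    exact ⟨⟨hdim, hdist⟩, isMSRD_of_isMinDist hm hk hN (i.pos) hdim hdist⟩

end Codes
end SubspaceDesign

theorem mainTheorem7 {F L : Type*} [Field F] [Finite F] [Field L] [Algebra F L]
    [FiniteDimensional F L] (m k t : ℕ) (hm : Module.finrank F L = m) (hm2 : 2 ≤ m)
    (U : Fin t → Submodule F (Fin k → L)) :
    (∀ (θ : L →+* L) (σ : (Fin k → L) →ₗ[L] (Fin k → L) →ₛₗ[θ] L),
      σ.IsRefl → σ.Nondegenerate → SubspaceDesign.IsMaximumDesign F L 1 U →
        SubspaceDesign.IsMaximumDesign F L 1 (fun i => SubspaceDesign.traceDual σ (U i))) ∧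
    (2 ≤ k → Even (m * k) → (∀ i, Module.finrank F (U i) = m * k / 2) →
      (SubspaceDesign.IsMaximumDesign F L 1 U ↔
        SubspaceDesign.IsSubspaceDesign F L (k - 1) (t * m * (k - 2) / 2 + 1) U)) ∧
    (2 ≤ k → Even (m * k) → (∀ i, Module.finrank F (U i) = m * k / 2) →
      SubspaceDesign.spanOver F L U = ⊤ →
      ((∀ C ∈ SubspaceDesign.associatedCodes F (fun _ : Fin t => m * k / 2) U,
          SubspaceDesign.IsCode F C k (m * t - 1) ∧ SubspaceDesign.IsMSRD F C) ↔
        SubspaceDesign.IsMaximumDesign F L 1 U)) := by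
  subst hm
  refine ⟨fun θ σ _ hσ hU => hU.traceDual hσ.1, fun hk heven hdim => ?_,
    fun hk heven hdim hspan => ?_⟩
  · obtain ⟨N, hN⟩ := heven
    have hN2 : Module.finrank F L * k = 2 * N := by omega
    have hdim' : ∀ i, Module.finrank F (U i) = N := fun i => by rw [hdim i]; omega
    have h := SubspaceDesign.isSubspaceDesign_iff (V := Fin k → L) (U := U) hm2
      (by rwa [Module.finrank_fin_fun]) hdim' (by rwa [Module.finrank_fin_fun])
    rw [Module.finrank_fin_fun] at h
    rw [h, SubspaceDesign.isMaximumDesign_iff_defect hm2 hdim' hN2]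
  · obtain ⟨N, hN⟩ := heven
    have hN2 : Module.finrank F L * k = 2 * N := by omega
    have hhalf : Module.finrank F L * k / 2 = N := by omega
    rw [hhalf] at hdim ⊢
    rw [SubspaceDesign.forall_associatedCodes_isMSRD_iff hm2 hk hN2 hdim hspan,
      SubspaceDesign.isMaximumDesign_iff_defect hm2 hdim hN2, hspan, finrank_top,
      Module.finrank_fin_fun]
    exact ⟨fun h => ⟨by omega, h⟩, fun h => h.2⟩
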